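/- Let $E$ be a finite-dimensional $\mathbb{Q}$-vector space with a positive definite symmetric bilinear form $(\,,\,)$, and put $e^\vee=\frac{2}{(e,e)}e$ for $0\neq e\in E$. Let $\Phi\subseteq E$ be an irreducible reduced crystallographic root system spanning $E$, with simple roots $\{\alpha_i\mid i\in I\}$ and Weyl group $W\subseteq \mathrm{GL}(E)$; let $s_i\in W$ be the reflection in $\alpha_i$. A weight $\lambda$ (a vector with $(\lambda,\alpha_i^\vee)\in\mathbb{Z}$ for all $i\in I$) is called minuscule if $\lambda\neq 0$, $(\lambda,\alpha_i^\vee)\geq 0$ for all $i\in I$, and $(\lambda,\alpha^\vee)\in\{0,\pm1\}$ for all $\alpha\in\Phi$. Let $\Psi\subseteq E$ be a non-empty union of $W$-orbits of minuscule weights. Let $R\neq 0$ be a commutative ring with $1$, and let $\bar M$ be a free $R$-module with a basis $\{\bar z_\mu\mid\mu\in\Psi\}$. For $i\in I$ let $\bar e_i,\bar f_i\colon\bar M\to\bar M$ be the $R$-linear maps such that $\bar e_i(\bar z_\mu)=\bar z_{\mu+\alpha_i}$ if $(\mu,\alpha_i^\vee)=-1$ and $\bar e_i(\bar z_\mu)=0$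 otherwise, and $\bar f_i(\bar z_\mu)=\bar z_{\mu-\alpha_i}$ if $(\mu,\alpha_i^\vee)=1$ and $\bar f_i(\bar z_\mu)=0$ otherwise. Then $\bar e_i^2=\bar f_i^2=0$, so that $x_i(t)=\mathrm{id}_{\bar M}+t\bar e_i$ and $y_i(t)=\mathrm{id}_{\bar M}+t\bar f_i$ lie in $\mathrm{GL}(\bar M)$ for all $t\in R$. For $t\in R^\times$ put $\bar n_i(t)=x_i(t)\,y_i(-t^{-1})\,x_i(t)$ and $h_i(t)=\bar n_i(t)\,\bar n_i(-1)$, and write $\bar n_i=\bar n_i(1)$. Let $N=\langle \bar n_i(t)\mid i\in I,\ t\in R^\times\rangle$ and $H=\langle h_i(t)\mid i\in I,\ t\in R^\times\rangle\subseteq N$. Then $H$ is a normal subgroup of $N$, and there is a unique group isomorphism $W\to N/H$ such that $s_i\mapsto \bar n_iH$ for all $i\in I$. -/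

import Mathlib

noncomputable section

open Module

namespace MinusculeChevalley

variable {ι E E' : Type*} [AddCommGroup E] [Module ℚ E] [AddCommGroup E'] [Module ℚ E']
  {P : RootPairing ι ℚ E E'}

/-- `(lam, α^∨)` is written `P.coroot' a lam` when `α` is the root with index `a`.
The weight lattice: all vectors whose pairings with the simple coroots are integers, i.e. the
`ℤ`-span of the basis dual to the simple coroots. -/
def weightLattice (b : P.Base) : AddSubgroup E where
  carrier := {lam | ∀ i : b.support, ∃ k : ℤ, P.coroot' i lam = k}
  zero_mem' := fun i => ⟨0, by simp⟩
  add_mem' := by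
    intro x y hx hy i
    obtain ⟨k, hk⟩ := hx i
    obtain ⟨l, hl⟩ := hy i
    exact ⟨k + l, by rw [map_add, hk, hl]; push_cast; rfl⟩
  neg_mem' := by
    intro x hx i
    obtain ⟨k, hk⟩ := hx i
    exact ⟨-k, by rw [map_neg, hk]; push_cast; rfl⟩

/-- A minuscule weight: a nonzero dominant weight `lam` with `(lam, α^∨) ∈ {0, 1, -1}` for every
root `α`. -/
structure IsMinuscule (b : P.Base) (lam : E) : Prop where
  mem_weightLattice : lam ∈ weightLattice b
  ne_zero : lam ≠ 0
  dominant : ∀ i : b.support, 0 ≤ P.coroot' i lam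
  coroot_apply : ∀ a : ι, P.coroot' a lam = 0 ∨ P.coroot' a lam = 1 ∨ P.coroot' a lam = -1

/-- `Psi` is a non-empty union of Weyl group orbits of minuscule weights. -/
structure IsMinusculeUnion (b : P.Base) (Psi : Set E) : Prop where
  nonempty : Psi.Nonempty
  eq_union : ∃ S : Set E, (∀ lam ∈ S, IsMinuscule b lam) ∧
    Psi = ⋃ lam ∈ S, MulAction.orbit P.weylGroup lam

variable {b : P.Base} {Psi : Set E}

theorem IsMinusculeUnion.reflection_mem (hPsi : IsMinusculeUnion b Psi) (a : ι) {mu : E}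
    (hmu : mu ∈ Psi) : mu - P.coroot' a mu • P.root a ∈ Psi := by
  obtain ⟨S, -, rfl⟩ := hPsi.eq_union
  simp only [Set.mem_iUnion] at hmu ⊢
  obtain ⟨lam, hlam, h⟩ := hmu
  refine ⟨lam, hlam, ?_⟩
  have h2 := MulAction.mem_orbit_of_mem_orbit (RootPairing.weylGroup.ofIdx P a) h
  have h3 : RootPairing.weylGroup.ofIdx P a • mu = mu - P.coroot' a mu • P.root a := by
    rw [RootPairing.weylGroup.ofIdx_smul]
    exact P.reflection_apply a mu
  rwa [h3] at h2

/-- If `(mu, α^∨) = -1`, then `mu + α` lies again in `Psi`. -/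
theorem IsMinusculeUnion.add_root_mem (hPsi : IsMinusculeUnion b Psi) (a : ι) {mu : E}
    (hmu : mu ∈ Psi) (h : P.coroot' a mu = -1) : mu + P.root a ∈ Psi := by
  have := hPsi.reflection_mem a hmu
  rwa [h, neg_one_smul, sub_neg_eq_add] at this

/-- If `(mu, α^∨) = 1`, then `mu - α` lies again in `Psi`. -/
theorem IsMinusculeUnion.sub_root_mem (hPsi : IsMinusculeUnion b Psi) (a : ι) {mu : E}
    (hmu : mu ∈ Psi) (h : P.coroot' a mu = 1) : mu - P.root a ∈ Psi := by
  have := hPsi.reflection_mem a hmu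
  rwa [h, one_smul] at this

variable {R V : Type*} [CommRing R] [AddCommGroup V] [Module R V]

/-- The map `e_i`: it sends `z_mu` to `z_{mu + α_i}` if `(mu, α_i^∨) = -1`, and to `0` otherwise. -/
def e (hPsi : IsMinusculeUnion b Psi) (z : Basis Psi R V) (i : b.support) : V →ₗ[R] V :=
  z.constr R fun mu =>
    if h : P.coroot' i mu = -1 then
      z ⟨(mu : E) + P.root i, hPsi.add_root_mem i mu.2 h⟩
    else 0

/-- The map `f_i`: it sends `z_mu` to `z_{mu - α_i}` if `(mu, α_i^∨) = 1`, and to `0` otherwise. -/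
def f (hPsi : IsMinusculeUnion b Psi) (z : Basis Psi R V) (i : b.support) : V →ₗ[R] V :=
  z.constr R fun mu =>
    if h : P.coroot' i mu = 1 then
      z ⟨(mu : E) - P.root i, hPsi.sub_root_mem i mu.2 h⟩
    else 0

variable (hPsi : IsMinusculeUnion b Psi) (z : Basis Psi R V)

theorem e_mul_e (i : b.support) : e hPsi z i * e hPsi z i = 0 := by
  refine z.ext fun mu => ?_
  rw [Module.End.mul_apply]
  by_cases h : P.coroot' i mu = -1
  · have h2 : ¬ P.coroot' i ((mu : E) + P.root i) = -1 := by
      rw [map_add, h, P.root_coroot'_eq_pairing, P.pairing_same]; norm_num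
    simp only [e, Basis.constr_basis, dif_pos h, dif_neg h2, LinearMap.zero_apply]
  · simp only [e, Basis.constr_basis, dif_neg h, map_zero, LinearMap.zero_apply]

theorem f_mul_f (i : b.support) : f hPsi z i * f hPsi z i = 0 := by
  refine z.ext fun mu => ?_
  rw [Module.End.mul_apply]
  by_cases h : P.coroot' i mu = 1
  · have h2 : ¬ P.coroot' i ((mu : E) - P.root i) = 1 := by
      rw [map_sub, h, P.root_coroot'_eq_pairing, P.pairing_same]; norm_num
    simp only [f, Basis.constr_basis, dif_pos h, dif_neg h2, LinearMap.zero_apply]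
  · simp only [f, Basis.constr_basis, dif_neg h, map_zero, LinearMap.zero_apply]

/-- The invertible map `id + a` for an endomorphism `a` with `a² = 0`. -/
def oneAdd (a : V →ₗ[R] V) (ha : a * a = 0) : LinearMap.GeneralLinearGroup R V where
  val := 1 + a
  inv := 1 - a
  val_inv := by rw [mul_sub, mul_one, add_mul, one_mul, ha]; abel
  inv_val := by rw [sub_mul, one_mul, mul_add, mul_one, ha]; abel

/-- `x_i(t) = id + t e_i`. -/
def x (i : b.support) (t : R) : LinearMap.GeneralLinearGroup R V :=
  oneAdd (t • e hPsi z i) (by rw [smul_mul_smul_comm, e_mul_e, smul_zero])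

/-- `y_i(t) = id + t f_i`. -/
def y (i : b.support) (t : R) : LinearMap.GeneralLinearGroup R V :=
  oneAdd (t • f hPsi z i) (by rw [smul_mul_smul_comm, f_mul_f, smul_zero])

/-- The Chevalley group `G`, generated by all `x_i(t)` and `y_i(t)`. -/
def G : Subgroup (LinearMap.GeneralLinearGroup R V) :=
  Subgroup.closure {g | ∃ (i : b.support) (t : R), g = x hPsi z i t ∨ g = y hPsi z i t}

/-- `n_i(t) = x_i(t) y_i(-t⁻¹) x_i(t)` for a unit `t`; the element `n_i` is `n_i(1)`. -/
def n (i : b.support) (t : Rˣ) : LinearMap.GeneralLinearGroup R V :=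
  x hPsi z i (t : R) * y hPsi z i (-((t⁻¹ : Rˣ) : R)) * x hPsi z i (t : R)

/-- `h_i(t) = n_i(t) n_i(-1)` for a unit `t`. -/
def h (i : b.support) (t : Rˣ) : LinearMap.GeneralLinearGroup R V :=
  n hPsi z i t * n hPsi z i (-1)

/-- The subgroup `H` generated by all `h_i(t)`. -/
def H : Subgroup (LinearMap.GeneralLinearGroup R V) :=
  Subgroup.closure {g | ∃ (i : b.support) (t : Rˣ), g = h hPsi z i t}

/-- The subgroup `N` generated by all `n_i(t)`. -/
def N : Subgroup (LinearMap.GeneralLinearGroup R V) :=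
  Subgroup.closure {g | ∃ (i : b.support) (t : Rˣ), g = n hPsi z i t}

theorem n_mem_N (i : b.support) (t : Rˣ) : n hPsi z i t ∈ N hPsi z :=
  Subgroup.subset_closure ⟨i, t, rfl⟩

theorem H_le_N : H hPsi z ≤ N hPsi z := by
  refine (Subgroup.closure_le _).2 ?_
  rintro _ ⟨i, t, rfl⟩
  exact mul_mem (n_mem_N hPsi z i t) (n_mem_N hPsi z i (-1))

theorem N_le_G : N hPsi z ≤ G hPsi z := by
  refine (Subgroup.closure_le _).2 ?_
  rintro _ ⟨i, t, rfl⟩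
  have hx : ∀ s : R, x hPsi z i s ∈ G hPsi z := fun s =>
    Subgroup.subset_closure ⟨i, s, Or.inl rfl⟩
  have hy : ∀ s : R, y hPsi z i s ∈ G hPsi z := fun s =>
    Subgroup.subset_closure ⟨i, s, Or.inr rfl⟩
  exact mul_mem (mul_mem (hx _) (hy _)) (hx _)

end MinusculeChevalley

end

/-!
In the basis `z`, every `n_i(t)` is a monomial matrix whose permutation is the action of `s_i` on
`Psi`, and the `h_i(t)` are diagonal. As the weights span `E`, an element of `W` is determined by
its permutation of `Psi`, so the point is to produce a homomorphism `W → N / H`.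

By the exchange condition, `W` is presented by `s_i² = 1` and the relations `w s_i = s_j w`, where
`w` is a word with `w α_i = α_j`. The latter hold modulo `H` if `w n_i(1) = n_j(±1) w` for the
corresponding word in the `n_i(1)`. As both sides have the same permutation, this is a statement on
signs that do not depend on `R`, so they may be compared over `ℚ`: conjugation by `w` preserves the
Lie algebra generated by the `e_i` and `f_i`, and in that Lie algebra every element of degree `α_j`
is a multiple of `e_j`. Hence `w e_i w⁻¹` has the same coefficient at all `(mu + α_j, mu)`.
-/

noncomputable section

open Module

namespace MinusculeChevalley

section Words

variable {α Q : Type*} [Group Q] {q : α → Q}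

theorem prod_map_reverse (hq : ∀ a, q a * q a = 1) (l : List α) :
    (l.reverse.map q).prod = ((l.map q).prod)⁻¹ := by
  have inv_eq (a : α) : (q a)⁻¹ = q a := inv_eq_of_mul_eq_one_left (hq a)
  simp only [List.prod_inv_reverse, List.map_map, List.map_reverse, Function.comp_def, inv_eq]

theorem prod_map_delete_pair (hq : ∀ a, q a * q a = 1) {l₁ l₂ : List α} {j k : α}
    (h : (l₂.map q).prod * q k = q j * (l₂.map q).prod) :
    ((l₁ ++ j :: l₂ ++ [k]).map q).prod = ((l₁ ++ l₂).map q).prod := by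
  simp only [List.map_append, List.map_cons, List.map_nil, List.prod_append, List.prod_cons,
    List.prod_nil, mul_one, mul_assoc]
  rw [h, ← mul_assoc (q j), hq, one_mul]

end Words

section WeylGroup

variable {ι k E E' : Type*} [CommRing k] [AddCommGroup E] [Module k E] [AddCommGroup E']
  [Module k E'] {P : RootPairing ι k E E'}

theorem weylGroup_ext {w w' : P.weylGroup} (hw : ∀ v : E, w • v = w' • v) : w = w' :=
  Subtype.ext <| RootPairing.Equiv.weightHom_injective P <| LinearEquiv.ext hw

theorem root_smul (w : P.weylGroup) (a : ι) : P.root (w • a) = w • P.root a :=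
  RootPairing.Equiv.root_indexEquiv_eq_smul P a w.1

theorem coroot'_smul (w : P.weylGroup) (a : ι) (v : E) :
    P.coroot' (w • a) (w • v) = P.coroot' a v := by
  have transpose := LinearMap.congr_fun (RootPairing.Hom.weight_coweight_transpose_apply P P
    (P.coroot (w • a)) w.1.toHom) v
  rwa [RootPairing.Hom.coroot_coweightMap_apply,
    show w.1.toHom.indexEquiv.symm (w • a) = a from w.1.toHom.indexEquiv.symm_apply_apply a]
    at transpose

theorem ofIdx_smul_eq_sub (a : ι) (v : E) :
    RootPairing.weylGroup.ofIdx P a • v = v - P.coroot' a v • P.root a := by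
  rw [RootPairing.weylGroup.ofIdx_smul]
  exact P.reflection_apply a v

theorem ofIdx_smul_index (a c : ι) :
    RootPairing.weylGroup.ofIdx P a • c = P.reflectionPerm a c := by
  apply P.root.injective
  rw [root_smul, RootPairing.weylGroup.ofIdx_smul, RootPairing.root_reflectionPerm]
  rfl

theorem ofIdx_mul_self (a : ι) :
    RootPairing.weylGroup.ofIdx P a * RootPairing.weylGroup.ofIdx P a = 1 :=
  weylGroup_ext fun v => P.reflection_same a v

theorem mul_ofIdx (w : P.weylGroup) (a : ι) :
    w * RootPairing.weylGroup.ofIdx P a = RootPairing.weylGroup.ofIdx P (w • a) * w := by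
  refine weylGroup_ext fun v => ?_
  rw [mul_smul, mul_smul, ofIdx_smul_eq_sub, ofIdx_smul_eq_sub, coroot'_smul, root_smul,
    smul_sub, smul_comm w]

/-- The simple reflection `s_i`. Words in the simple reflections are lists in `b.support`. -/
def simpleReflection (b : P.Base) (i : b.support) : P.weylGroup :=
  RootPairing.weylGroup.ofIdx P i

theorem simpleReflection_mul_self (b : P.Base) (i : b.support) :
    simpleReflection b i * simpleReflection b i = 1 :=
  ofIdx_mul_self (i : ι)

theorem mul_simpleReflection {b : P.Base} {w : P.weylGroup} {i j : b.support}
    (hij : w • (i : ι) = j) : w * simpleReflection b i = simpleReflection b j * w := by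
  rw [simpleReflection, mul_ofIdx, hij, simpleReflection]

theorem not_isPos_simpleReflection_smul [CharZero k] (b : P.Base) (i : b.support) :
    ¬ b.IsPos (simpleReflection b i • (i : ι)) := by
  let := P.indexNeg
  rw [simpleReflection, ofIdx_smul_index]
  exact (RootPairing.Base.IsPos.neg_iff_not b (i : ι)).not.2
    (not_not.2 (b.isPos_of_mem_support i.2))

variable [Finite ι] [CharZero k] [IsDomain k] [P.IsCrystallographic] [P.IsReduced]

theorem closure_range_simpleReflection (b : P.Base) :
    Subgroup.closure (Set.range (simpleReflection b)) = ⊤ := by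
  set K := Subgroup.closure (Set.range (simpleReflection b))
  have simple_mem : ∀ i ∈ b.support, RootPairing.weylGroup.ofIdx P i ∈ K := fun i hi =>
    Subgroup.subset_closure ⟨⟨i, hi⟩, rfl⟩
  have conj_mem (a c : ι) (ha : RootPairing.weylGroup.ofIdx P a ∈ K)
      (hc : RootPairing.weylGroup.ofIdx P c ∈ K) :
      RootPairing.weylGroup.ofIdx P (P.reflectionPerm a c) ∈ K := by
    rw [← ofIdx_smul_index, ← mul_inv_eq_of_eq_mul (mul_ofIdx _ c)]
    exact mul_mem (mul_mem ha hc) (inv_mem ha)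
  have reflection_mem (a : ι) : RootPairing.weylGroup.ofIdx P a ∈ K :=
    b.induction_reflect a (fun i hi => conj_mem i i hi hi) simple_mem
      fun i j hi hj => conj_mem j i (simple_mem j hj) hi
  rw [eq_top_iff]
  rintro ⟨w, hw⟩ -
  induction hw using RootPairing.weylGroup.induction with
  | mem i => exact reflection_mem i
  | one => exact one_mem _
  | mul x y hx hy hx' hy' => exact mul_mem hx' hy'

variable {b : P.Base}

theorem exists_prod_simpleReflection_eq (w : P.weylGroup) :
    ∃ l : List b.support, (l.map (simpleReflection b)).prod = w := by
  have hw : w ∈ Subgroup.closure (Set.range (simpleReflection b)) :=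
    closure_range_simpleReflection b ▸ Subgroup.mem_top w
  induction hw using Subgroup.closure_induction'' with
  | one => exact ⟨[], rfl⟩
  | mem _ hs =>
    obtain ⟨i, rfl⟩ := hs
    exact ⟨[i], List.prod_singleton⟩
  | inv_mem _ hs =>
    obtain ⟨i, rfl⟩ := hs
    exact ⟨[i], List.prod_singleton.trans
      (eq_inv_of_mul_eq_one_left (simpleReflection_mul_self b i))⟩
  | mul _ _ _ _ hx hy =>
    obtain ⟨l, rfl⟩ := hx
    obtain ⟨l', rfl⟩ := hy
    exact ⟨l ++ l', by rw [List.map_append, List.prod_append]⟩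

theorem exists_eq_append_cons_of_not_isPos (l : List b.support) (i : b.support)
    (h : ¬ b.IsPos ((l.map (simpleReflection b)).prod • (i : ι))) :
    ∃ (l₁ : List b.support) (j : b.support) (l₂ : List b.support),
      l = l₁ ++ j :: l₂ ∧ (l₂.map (simpleReflection b)).prod • (i : ι) = j := by
  induction l with
  | nil => exact absurd (b.isPos_of_mem_support i.2) (by simpa using h)
  | cons a l ih =>
    by_cases hl : b.IsPos ((l.map (simpleReflection b)).prod • (i : ι))
    · refine ⟨[], a, l, rfl, ?_⟩
      by_contra hne
      refine h ?_
      rw [List.map_cons, List.prod_cons, mul_smul, simpleReflection, ofIdx_smul_index]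
      exact hl.reflectionPerm a.2 hne
    · obtain ⟨l₁, j, l₂, rfl, hj⟩ := ih hl
      exact ⟨a :: l₁, j, l₂, rfl, hj⟩

variable {Q : Type*} [Group Q] {q : b.support → Q}

theorem prod_map_eq_one_of_prod_simpleReflection_eq_one (hq : ∀ i, q i * q i = 1)
    (hconj : ∀ (l : List b.support) (i j : b.support),
      (l.map (simpleReflection b)).prod • (i : ι) = j →
        (l.map q).prod * q i = q j * (l.map q).prod)
    (l : List b.support) (hl : (l.map (simpleReflection b)).prod = 1) :
    (l.map q).prod = 1 := by
  induction hlen : l.length using Nat.strong_induction_on generalizing l with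
  | _ len ih =>
    obtain rfl | ⟨l', k, rfl⟩ := List.eq_nil_or_concat' l
    · rfl
    have hl' : (l'.map (simpleReflection b)).prod = simpleReflection b k := by
      rw [List.map_append, List.prod_append, List.map_singleton, List.prod_singleton] at hl
      rw [eq_inv_of_mul_eq_one_left hl,
        inv_eq_of_mul_eq_one_left (simpleReflection_mul_self b k)]
    obtain ⟨l₁, j, l₂, rfl, hj⟩ := exists_eq_append_cons_of_not_isPos l' k
      (hl' ▸ not_isPos_simpleReflection_smul b k)
    rw [prod_map_delete_pair (simpleReflection_mul_self b) (mul_simpleReflection hj)] at hl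
    rw [prod_map_delete_pair hq (hconj l₂ k j hj)]
    refine ih (l₁ ++ l₂).length ?_ (l₁ ++ l₂) hl rfl
    simp only [← hlen, List.length_append, List.length_cons, List.length_nil]
    lia

/-- A presentation of the Weyl group, with all relations `w s_i = s_j w` for `w α_i = α_j` in place
of the braid relations. -/
theorem exists_monoidHom_simpleReflection (hq : ∀ i, q i * q i = 1)
    (hconj : ∀ (l : List b.support) (i j : b.support),
      (l.map (simpleReflection b)).prod • (i : ι) = j →
        (l.map q).prod * q i = q j * (l.map q).prod) :
    ∃ φ : P.weylGroup →* Q, ∀ i, φ (simpleReflection b i) = q i := by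
  have prod_eq (l l' : List b.support) (h : (l.map (simpleReflection b)).prod =
      (l'.map (simpleReflection b)).prod) : (l.map q).prod = (l'.map q).prod := by
    have := prod_map_eq_one_of_prod_simpleReflection_eq_one hq hconj (l ++ l'.reverse) (by
      rw [List.map_append, List.prod_append, prod_map_reverse (simpleReflection_mul_self b), h,
        mul_inv_cancel])
    rwa [List.map_append, List.prod_append, prod_map_reverse hq, mul_inv_eq_one] at this
  obtain ⟨φ, hφ⟩ := MonoidHom.exists_mrange_eq_mgraph
    (f := (FreeMonoid.lift (simpleReflection b)).prod (FreeMonoid.lift q))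
    (fun w => (exists_prod_simpleReflection_eq w).imp fun l hl =>
      (FreeMonoid.lift_apply _ (FreeMonoid.ofList l)).trans hl)
    fun l l' => by
      simpa only [MonoidHom.prod_apply, FreeMonoid.lift_apply] using prod_eq l.toList l'.toList
  refine ⟨φ, fun i => ?_⟩
  have : (simpleReflection b i, q i) ∈ φ.mgraph := hφ ▸ ⟨FreeMonoid.of i, by simp⟩
  exact this

end WeylGroup

section Monomial

variable {κ R V : Type*} [CommRing R] [AddCommGroup V] [Module R V] {z : Basis κ R V}

/-- `g` is monomial in the basis `z`: its matrix is the product of the permutation matrix of `σ` and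
an invertible diagonal matrix, with entries indexed by the columns. -/
def IsMonomial (z : Basis κ R V) (σ : Equiv.Perm κ) (c : κ → Rˣ)
    (g : LinearMap.GeneralLinearGroup R V) : Prop :=
  ∀ k, (g : V →ₗ[R] V) (z k) = c k • z (σ k)

theorem IsMonomial.one : IsMonomial z 1 1 1 := fun k => (one_smul Rˣ (z k)).symm

theorem IsMonomial.mul {σ σ' : Equiv.Perm κ} {c c' : κ → Rˣ}
    {g g' : LinearMap.GeneralLinearGroup R V} (hg : IsMonomial z σ c g)
    (hg' : IsMonomial z σ' c' g') :
    IsMonomial z (σ * σ') (fun k => c' k * c (σ' k)) (g * g') := fun k => by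
  rw [Units.val_mul, Module.End.mul_apply, hg' k, Units.smul_def, map_smul, hg (σ' k), mul_smul,
    Equiv.Perm.mul_apply, Units.smul_def (c' k)]

theorem IsMonomial.congr {σ σ' : Equiv.Perm κ} {c c' : κ → Rˣ}
    {g : LinearMap.GeneralLinearGroup R V} (hg : IsMonomial z σ c g) (hσ : σ = σ')
    (hc : ∀ k, c k = c' k) : IsMonomial z σ' c' g := by
  obtain rfl := hσ
  obtain rfl := funext hc
  exact hg

theorem IsMonomial.eq {σ : Equiv.Perm κ} {c : κ → Rˣ} {g g' : LinearMap.GeneralLinearGroup R V}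
    (hg : IsMonomial z σ c g) (hg' : IsMonomial z σ c g') : g = g' :=
  Units.ext (z.ext fun k => (hg k).trans (hg' k).symm)

theorem IsMonomial.inv_apply {σ : Equiv.Perm κ} {c : κ → Rˣ}
    {g : LinearMap.GeneralLinearGroup R V} (hg : IsMonomial z σ c g) (k : κ) :
    ((g⁻¹ : LinearMap.GeneralLinearGroup R V) : V →ₗ[R] V) (z (σ k)) = (c k)⁻¹ • z k := by
  rw [eq_inv_smul_iff, Units.smul_def, ← map_smul, ← Units.smul_def, ← hg k,
    ← Module.End.mul_apply, Units.inv_mul, Module.End.one_apply]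

theorem IsMonomial.inv {σ : Equiv.Perm κ} {c : κ → Rˣ} {g : LinearMap.GeneralLinearGroup R V}
    (hg : IsMonomial z σ c g) : IsMonomial z σ⁻¹ (fun k => (c (σ⁻¹ k))⁻¹) g⁻¹ := fun k => by
  rw [← hg.inv_apply, ← Equiv.Perm.mul_apply, mul_inv_cancel, Equiv.Perm.one_apply]

theorem IsMonomial.conj_apply {σ : Equiv.Perm κ} {c : κ → Rˣ}
    {g : LinearMap.GeneralLinearGroup R V} (hg : IsMonomial z σ c g) {A : Module.End R V} {k l : κ}
    (hA : A (z k) = z l) :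
    ((g : Module.End R V) * A * (g⁻¹ : LinearMap.GeneralLinearGroup R V)) (z (σ k)) =
      (c l * (c k)⁻¹) • z (σ l) := by
  rw [Module.End.mul_apply, Module.End.mul_apply, hg.inv_apply, Units.smul_def, map_smul, hA,
    map_smul, hg l, mul_comm, mul_smul, Units.smul_def (c k)⁻¹]

theorem IsMonomial.perm_eq [Nontrivial R] {σ σ' : Equiv.Perm κ} {c c' : κ → Rˣ}
    {g : LinearMap.GeneralLinearGroup R V} (hg : IsMonomial z σ c g)
    (hg' : IsMonomial z σ' c' g) : σ = σ' := by
  classical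
  ext k
  by_contra hne
  have hrepr := DFunLike.congr_fun (congrArg z.repr ((hg k).symm.trans (hg' k))) (σ k)
  simp only [Units.smul_def, map_smul, Basis.repr_self, Finsupp.smul_single, smul_eq_mul, mul_one,
    Finsupp.single_eq_same, Finsupp.single_eq_of_ne hne] at hrepr
  exact (c k).ne_zero hrepr

end Monomial

attribute [local instance] LieRing.ofAssociativeRing

section Degree

variable {κ Γ R V : Type*} [AddCommGroup Γ] [CommRing R] [AddCommGroup V] [Module R V]

/-- `A` is homogeneous of degree `γ` when `V` is graded by giving each basis vector `z k` the
degree `d k`. -/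
def HasDegree (z : Basis κ R V) (d : κ → Γ) (γ : Γ) (A : Module.End R V) : Prop :=
  ∀ q, ∀ v ∈ Submodule.span R (z '' (d ⁻¹' {q})), A v ∈ Submodule.span R (z '' (d ⁻¹' {q + γ}))

variable {z : Basis κ R V} {d : κ → Γ} {γ γ' : Γ} {A B : Module.End R V}

theorem HasDegree.of_basis
    (hA : ∀ k, A (z k) ∈ Submodule.span R (z '' (d ⁻¹' {d k + γ}))) : HasDegree z d γ A := by
  intro q
  change Submodule.span R _ ≤ (Submodule.span R _).comap A
  refine Submodule.span_le.2 ?_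
  rintro _ ⟨k, rfl, rfl⟩
  exact hA k

theorem HasDegree.mul (hA : HasDegree z d γ A) (hB : HasDegree z d γ' B) :
    HasDegree z d (γ' + γ) (A * B) := fun q v hv => by
  rw [← add_assoc]
  exact hA _ _ (hB q v hv)

theorem HasDegree.lie (hA : HasDegree z d γ A) (hB : HasDegree z d γ' B) :
    HasDegree z d (γ + γ') ⁅A, B⁆ := fun q v hv =>
  sub_mem (add_comm γ γ' ▸ hA.mul hB q v hv) (hB.mul hA q v hv)

theorem HasDegree.repr_eq_zero (hA : HasDegree z d γ A) {k l : κ} (hne : d l ≠ d k + γ) :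
    z.repr (A (z k)) l = 0 := by
  have hmem := hA _ _ (Submodule.subset_span ⟨k, rfl, rfl⟩)
  rw [Basis.mem_span_image] at hmem
  by_contra h0
  exact hne (hmem (Finsupp.mem_support_iff.2 h0))

end Degree

section LieAlgebra

variable {I K L : Type*} [CommRing K] [LieRing L] [LieAlgebra K L]

/-- The iterated brackets `[a_i, [a_j, ..., [a_k, a_l]]]` in the members of a family `a`. -/
inductive IteratedBracket (a : I → L) : L → Prop
  | base (i : I) : IteratedBracket a (a i)
  | step (i : I) {v : L} : IteratedBracket a v → IteratedBracket a ⁅a i, v⁆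

theorem IteratedBracket.exists_hasDegree {I κ Γ R V : Type*} [AddCommGroup Γ] [CommRing R]
    [AddCommGroup V] [Module R V] {z : Basis κ R V} {d : κ → Γ} {a : I → Module.End R V} {δ : I → Γ}
    (ha : ∀ i, HasDegree z d (δ i) (a i)) {Γ' : Type*} [AddCommGroup Γ'] (ht : Γ →+ Γ') {m : Γ'}
    (hδ : ∀ i, ht (δ i) = m) {A : Module.End R V} (hA : IteratedBracket a A) :
    ∃ (k : ℕ) (γ : Γ), HasDegree z d γ A ∧ ht γ = (k + 1) • m ∧ (k = 0 → ∃ i, a i = A) := by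
  induction hA with
  | base i => exact ⟨0, δ i, ha i, by rw [hδ, zero_add, one_smul], fun _ => ⟨i, rfl⟩⟩
  | step i _ ih =>
    obtain ⟨k, γ, hγ, htγ, -⟩ := ih
    exact ⟨k + 1, δ i + γ, (ha i).lie hγ, by rw [map_add, hδ, htγ, succ_nsmul' _ (k + 1)],
      fun hk => absurd hk k.succ_ne_zero⟩

variable (K) in
/-- The relations of Chevalley generators that raising operators `a` and lowering operators `c`
satisfy, where the Cartan integers may be arbitrary scalars and `[h_i, h_j] = 0` is left out. -/
structure ChevalleyRelations (a c : I → L) : Prop where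
  lie_of_ne : ∀ i j, i ≠ j → ⁅a i, c j⁆ = 0
  left : ∀ i j, ∃ k : K, ⁅⁅a i, c i⁆, a j⁆ = k • a j
  right : ∀ i j, ∃ k : K, ⁅⁅a i, c i⁆, c j⁆ = k • c j

variable (K) in
/-- The span of the iterated brackets in `a`, those in `c`, and the elements `[a_i, c_i]`: the
triangular decomposition of the Lie algebra generated by `a` and `c`. -/
def triangularSpan (a c : I → L) : Submodule K L :=
  Submodule.span K ({v | IteratedBracket a v} ∪ Set.range (fun i => ⁅a i, c i⁆) ∪
    {v | IteratedBracket c v})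

theorem lie_mem_of_mem_span {s : Set L} {T : Submodule K L} {u v : L}
    (hs : ∀ w ∈ s, ⁅u, w⁆ ∈ T) (hv : v ∈ Submodule.span K s) : ⁅u, v⁆ ∈ T :=
  (Submodule.span_le (p := T.comap (LieAlgebra.ad K L u))).2 hs hv

variable {a c : I → L}

theorem ChevalleyRelations.symm (hac : ChevalleyRelations K a c) : ChevalleyRelations K c a where
  lie_of_ne i j hij := by rw [← lie_skew, hac.lie_of_ne j i hij.symm, neg_zero]
  left i j := by
    obtain ⟨k, hk⟩ := hac.right i j
    exact ⟨-k, by rw [← lie_skew (c i), neg_lie, hk, neg_smul]⟩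
  right i j := by
    obtain ⟨k, hk⟩ := hac.left i j
    exact ⟨-k, by rw [← lie_skew (c i), neg_lie, hk, neg_smul]⟩

theorem triangularSpan_comm_le (a c : I → L) : triangularSpan K c a ≤ triangularSpan K a c := by
  refine Submodule.span_le.2 ?_
  rintro v ((hv | ⟨i, rfl⟩) | hv)
  · exact Submodule.subset_span (Or.inr hv)
  · change ⁅c i, a i⁆ ∈ triangularSpan K a c
    rw [← lie_skew]
    exact neg_mem (Submodule.subset_span (Or.inl (Or.inr ⟨i, rfl⟩)))
  · exact Submodule.subset_span (Or.inl (Or.inl hv))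

theorem ChevalleyRelations.lie_iteratedBracket (hac : ChevalleyRelations K a c) (i : I) {v : L}
    (hv : IteratedBracket a v) : ∃ k : K, ⁅⁅a i, c i⁆, v⁆ = k • v := by
  induction hv with
  | base j => exact hac.left i j
  | step j _ ih =>
    obtain ⟨k, hk⟩ := hac.left i j
    obtain ⟨k', hk'⟩ := ih
    exact ⟨k + k', by rw [leibniz_lie, hk, hk', lie_smul, smul_lie, add_smul]⟩

theorem ChevalleyRelations.raise_mem (hac : ChevalleyRelations K a c) (i : I) {v : L}
    (hv : v ∈ Submodule.span K ({v | IteratedBracket a v} ∪ Set.range fun i => ⁅a i, c i⁆)) :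
    ⁅a i, v⁆ ∈ Submodule.span K {v | IteratedBracket a v} := by
  refine lie_mem_of_mem_span ?_ hv
  rintro w (hw | ⟨j, rfl⟩)
  · exact Submodule.subset_span (IteratedBracket.step i hw)
  · obtain ⟨k, hk⟩ := hac.left j i
    rw [← lie_skew, hk]
    exact neg_mem (Submodule.smul_mem _ _ (Submodule.subset_span (.base i)))

theorem ChevalleyRelations.lower_mem (hac : ChevalleyRelations K a c) (j : I) {v : L}
    (hv : IteratedBracket a v) :
    ⁅c j, v⁆ ∈ Submodule.span K ({v | IteratedBracket a v} ∪ Set.range fun i => ⁅a i, c i⁆) := by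
  classical
  induction hv with
  | base i =>
    rw [← lie_skew]
    rcases eq_or_ne i j with rfl | hij
    · exact neg_mem (Submodule.subset_span (Or.inr ⟨i, rfl⟩))
    · rw [hac.lie_of_ne i j hij, neg_zero]
      exact zero_mem _
  | @step i v hv ih =>
    rw [leibniz_lie, ← lie_skew (c j) (a i), neg_lie]
    refine add_mem (neg_mem ?_)
      (Submodule.span_mono Set.subset_union_left (hac.raise_mem i ih))
    rcases eq_or_ne i j with rfl | hij
    · obtain ⟨k, hk⟩ := hac.lie_iteratedBracket i hv
      rw [hk]
      exact Submodule.smul_mem _ _ (Submodule.subset_span (Or.inl hv))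
    · rw [hac.lie_of_ne i j hij, zero_lie]
      exact zero_mem _

theorem ChevalleyRelations.lie_left_mem (hac : ChevalleyRelations K a c) (i : I) {v : L}
    (hv : v ∈ triangularSpan K a c) : ⁅a i, v⁆ ∈ triangularSpan K a c := by
  refine lie_mem_of_mem_span ?_ hv
  rintro w (hw | hw)
  · exact Submodule.span_mono (Set.subset_union_left.trans Set.subset_union_left)
      (hac.raise_mem i (Submodule.subset_span hw))
  · exact triangularSpan_comm_le a c
      (Submodule.span_mono Set.subset_union_left (hac.symm.lower_mem i hw))

theorem ChevalleyRelations.lie_right_mem (hac : ChevalleyRelations K a c) (i : I) {v : L}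
    (hv : v ∈ triangularSpan K a c) : ⁅c i, v⁆ ∈ triangularSpan K a c :=
  triangularSpan_comm_le a c (hac.symm.lie_left_mem i (triangularSpan_comm_le c a hv))

end LieAlgebra

section Conjugation

variable {R V : Type*} [CommRing R] [AddCommGroup V] [Module R V]

/-- Conjugation by `1 + a` with `a² = 0` is the exponential of `ad a`, as
`(1 + a) A (1 - a) = A + [a, A] - a A a` and `2 a A a = -[a, [a, A]]`. -/
theorem oneAdd_conj_mem (h2 : IsUnit (2 : R)) {T : Submodule R (Module.End R V)}
    {a : Module.End R V} (ha : a * a = 0) (hT : ∀ A ∈ T, ⁅a, A⁆ ∈ T) {A : Module.End R V}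
    (hA : A ∈ T) :
    (oneAdd a ha : Module.End R V) * A * ((oneAdd a ha)⁻¹ : LinearMap.GeneralLinearGroup R V) ∈
      T := by
  have double_bracket : (2 : R) • (a * A * a) = -⁅a, ⁅a, A⁆⁆ := by
    have haA : a * (a * A) = 0 := by rw [← mul_assoc, ha, zero_mul]
    have hAa : A * a * a = 0 := by rw [mul_assoc, ha, mul_zero]
    rw [Ring.lie_def, Ring.lie_def, mul_sub, sub_mul, haA, hAa, two_smul, mul_assoc]
    abel
  have sandwich_mem : a * A * a ∈ T :=
    (T.smul_mem_iff_of_isUnit h2).1 (double_bracket ▸ neg_mem (hT _ (hT _ hA)))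
  have conj_eq : (1 + a) * A * (1 - a) = A + ⁅a, A⁆ - a * A * a := by
    rw [Ring.lie_def]
    noncomm_ring
  change (1 + a) * A * (1 - a) ∈ T
  exact conj_eq ▸ sub_mem (add_mem hA (hT _ hA)) sandwich_mem

end Conjugation

section Weights

variable {ι E E' : Type*} [AddCommGroup E] [Module ℚ E] [AddCommGroup E'] [Module ℚ E']
  {P : RootPairing ι ℚ E E'} {b : P.Base} {Psi : Set E}

theorem IsMinusculeUnion.smul_mem (hPsi : IsMinusculeUnion b Psi) (w : P.weylGroup) {mu : E}
    (hmu : mu ∈ Psi) : w • mu ∈ Psi := by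
  obtain ⟨S, -, rfl⟩ := hPsi.eq_union
  simp only [Set.mem_iUnion] at hmu ⊢
  obtain ⟨lam, hlam, hmu⟩ := hmu
  exact ⟨lam, hlam, MulAction.mem_orbit_of_mem_orbit w hmu⟩

theorem IsMinusculeUnion.coroot'_apply (hPsi : IsMinusculeUnion b Psi) (a : ι) {mu : E}
    (hmu : mu ∈ Psi) : P.coroot' a mu = 0 ∨ P.coroot' a mu = 1 ∨ P.coroot' a mu = -1 := by
  obtain ⟨S, hS, rfl⟩ := hPsi.eq_union
  simp only [Set.mem_iUnion] at hmu
  obtain ⟨lam, hlam, w, rfl⟩ := hmu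
  have := (hS lam hlam).coroot_apply (w⁻¹ • a)
  rwa [← coroot'_smul w, smul_inv_smul] at this

theorem IsMinusculeUnion.exists_ne_zero (hPsi : IsMinusculeUnion b Psi) :
    ∃ mu ∈ Psi, mu ≠ 0 := by
  obtain ⟨mu, hmu⟩ := hPsi.nonempty
  obtain ⟨S, hS, rfl⟩ := hPsi.eq_union
  simp only [Set.mem_iUnion] at hmu
  obtain ⟨lam, hlam, -⟩ := hmu
  exact ⟨lam, Set.mem_biUnion hlam (MulAction.mem_orbit_self lam), (hS lam hlam).ne_zero⟩

theorem IsMinusculeUnion.span_eq_top [P.IsIrreducible] (hPsi : IsMinusculeUnion b Psi) :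
    Submodule.span ℚ Psi = ⊤ := by
  refine RootPairing.IsIrreducible.eq_top_of_invtSubmodule_reflection (P := P) _ (fun a => ?_) ?_
  · rw [Module.End.mem_invtSubmodule, Submodule.span_le]
    intro mu hmu
    exact Submodule.subset_span (hPsi.smul_mem (RootPairing.weylGroup.ofIdx P a) hmu)
  · obtain ⟨mu, hmu, h0⟩ := hPsi.exists_ne_zero
    exact (Submodule.ne_bot_iff _).2 ⟨mu, Submodule.subset_span hmu, h0⟩

theorem IsMinusculeUnion.eq_one_of_forall_smul_eq [P.IsIrreducible]
    (hPsi : IsMinusculeUnion b Psi) {w : P.weylGroup} (hw : ∀ mu ∈ Psi, w • mu = mu) : w = 1 := by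
  have eq_id : DistribSMul.toLinearMap ℚ E w = LinearMap.id := LinearMap.ext_on hPsi.span_eq_top hw
  exact weylGroup_ext fun v => (LinearMap.congr_fun eq_id v).trans (one_smul _ v).symm

/-- The action of the Weyl group on `Psi`. -/
def IsMinusculeUnion.weylPerm (hPsi : IsMinusculeUnion b Psi) : P.weylGroup →* Equiv.Perm Psi :=
  MulAction.toPermHom P.weylGroup (SubMulAction.mk Psi fun w _ => hPsi.smul_mem w)

theorem IsMinusculeUnion.coe_weylPerm (hPsi : IsMinusculeUnion b Psi) (w : P.weylGroup)
    (mu : Psi) : (hPsi.weylPerm w mu : E) = w • (mu : E) :=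
  rfl

variable (P) in
/-- The integer `(v, α^∨)` for the root `α` with index `a`. It is a junk value (the numerator) when
the pairing is not an integer, which does not happen for `v ∈ Psi`. -/
def weightPairing (a : ι) (v : E) : ℤ :=
  (P.coroot' a v).num

theorem weightPairing_smul (w : P.weylGroup) (a : ι) (v : E) :
    weightPairing P (w • a) (w • v) = weightPairing P a v :=
  congrArg Rat.num (coroot'_smul w a v)

theorem weightPairing_simpleReflection_smul_self (i : b.support) (v : E) :
    weightPairing P i (simpleReflection b i • v) = -weightPairing P i v := by
  have coroot'_neg : P.coroot' i (simpleReflection b i • v) = -P.coroot' i v := by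
    rw [simpleReflection, ofIdx_smul_eq_sub, map_sub, map_smul, P.root_coroot'_eq_pairing,
      P.pairing_same, smul_eq_mul]
    ring
  rw [weightPairing, weightPairing, coroot'_neg, Rat.num_neg_eq_neg_num]

theorem IsMinusculeUnion.cast_weightPairing (hPsi : IsMinusculeUnion b Psi) (a : ι) {mu : E}
    (hmu : mu ∈ Psi) : (weightPairing P a mu : ℚ) = P.coroot' a mu := by
  rcases hPsi.coroot'_apply a hmu with h0 | h0 | h0 <;> rw [weightPairing, h0] <;> rfl

theorem IsMinusculeUnion.weightPairing_eq (hPsi : IsMinusculeUnion b Psi) (a : ι) (mu : Psi) :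
    weightPairing P a mu = 0 ∨ weightPairing P a mu = 1 ∨ weightPairing P a mu = -1 := by
  exact_mod_cast hPsi.cast_weightPairing a mu.2 ▸ hPsi.coroot'_apply a mu.2

theorem IsMinusculeUnion.simpleReflection_smul (hPsi : IsMinusculeUnion b Psi) (i : b.support)
    (mu : Psi) : simpleReflection b i • (mu : E) = mu - weightPairing P i mu • P.root i := by
  rw [simpleReflection, ofIdx_smul_eq_sub, ← hPsi.cast_weightPairing i mu.2, Int.cast_smul_eq_zsmul]

theorem IsMinusculeUnion.weylPerm_simpleReflection_of_eq_zero (hPsi : IsMinusculeUnion b Psi)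
    {i : b.support} {mu : Psi} (h0 : weightPairing P i mu = 0) :
    hPsi.weylPerm (simpleReflection b i) mu = mu :=
  Subtype.ext <| by rw [hPsi.coe_weylPerm, hPsi.simpleReflection_smul, h0, zero_smul, sub_zero]

theorem IsMinusculeUnion.weylPerm_simpleReflection_twice (hPsi : IsMinusculeUnion b Psi)
    (i : b.support) (mu : Psi) :
    hPsi.weylPerm (simpleReflection b i) (hPsi.weylPerm (simpleReflection b i) mu) = mu := by
  rw [← Equiv.Perm.mul_apply, ← map_mul, simpleReflection_mul_self, map_one, Equiv.Perm.one_apply]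

theorem IsMinusculeUnion.weightPairing_simpleReflection_smul [P.IsCrystallographic]
    (hPsi : IsMinusculeUnion b Psi) (i : b.support) (a : ι) (mu : Psi) :
    weightPairing P a (simpleReflection b i • (mu : E)) =
      weightPairing P a mu - weightPairing P i mu * P.pairingIn ℤ i a := by
  have pairingIn_cast : ((P.pairingIn ℤ i a : ℤ) : ℚ) = P.pairing i a :=
    P.algebraMap_pairingIn ℤ i a
  refine Int.cast_injective (α := ℚ) ?_
  rw [hPsi.cast_weightPairing a (hPsi.smul_mem _ mu.2), hPsi.simpleReflection_smul, map_sub,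
    map_zsmul, P.root_coroot'_eq_pairing, ← pairingIn_cast, ← hPsi.cast_weightPairing a mu.2]
  push_cast
  rw [zsmul_eq_mul]

end Weights

section Generators

variable {ι E E' : Type*} [AddCommGroup E] [Module ℚ E] [AddCommGroup E'] [Module ℚ E']
  {P : RootPairing ι ℚ E E'} {b : P.Base} {Psi : Set E}
  {R V : Type*} [CommRing R] [AddCommGroup V] [Module R V]
  (hPsi : IsMinusculeUnion b Psi) (z : Basis Psi R V)

theorem e_apply (i : b.support) (mu : Psi) :
    e hPsi z i (z mu) =
      if weightPairing P i mu = -1 then z (hPsi.weylPerm (simpleReflection b i) mu) else 0 := by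
  have hcast := hPsi.cast_weightPairing i mu.2
  rw [e, Basis.constr_basis]
  refine dite_congr (propext ?_) (fun hmu => ?_) fun _ => rfl
  · rw [← hcast]
    norm_cast
  · refine congrArg z (Subtype.ext ((hPsi.simpleReflection_smul i mu).trans ?_).symm)
    change _ = (mu : E) + P.root i
    rw [hmu, neg_one_smul, sub_neg_eq_add]

theorem f_apply (i : b.support) (mu : Psi) :
    f hPsi z i (z mu) =
      if weightPairing P i mu = 1 then z (hPsi.weylPerm (simpleReflection b i) mu) else 0 := by
  have hcast := hPsi.cast_weightPairing i mu.2
  rw [f, Basis.constr_basis]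
  refine dite_congr (propext ?_) (fun hmu => ?_) fun _ => rfl
  · rw [← hcast]
    norm_cast
  · refine congrArg z (Subtype.ext ((hPsi.simpleReflection_smul i mu).trans ?_).symm)
    change _ = (mu : E) - P.root i
    rw [hmu, one_smul]

theorem x_apply (i : b.support) (t : R) (v : V) :
    (x hPsi z i t : Module.End R V) v = v + t • e hPsi z i v :=
  rfl

theorem y_apply (i : b.support) (t : R) (v : V) :
    (y hPsi z i t : Module.End R V) v = v + t • f hPsi z i v :=
  rfl

/-- The sign of `n_i(1)` on a basis vector of `α_i^∨`-weight `m ∈ {0, 1, -1}`. -/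
def reflSign (m : ℤ) : ℤˣ :=
  if m = 1 then -1 else 1

variable (R) in
/-- Signs as units of the coefficient ring. -/
def signUnit : ℤˣ →* Rˣ :=
  Units.map (Int.castRingHom R)

theorem isMonomial_n (i : b.support) (t : Rˣ) :
    IsMonomial z (hPsi.weylPerm (simpleReflection b i))
      (fun mu => signUnit R (reflSign (weightPairing P i mu)) * t ^ (-weightPairing P i mu))
      (n hPsi z i t) := by
  intro mu
  have weight_s : weightPairing P i (hPsi.weylPerm (simpleReflection b i) mu : E) =
      -weightPairing P i mu :=
    weightPairing_simpleReflection_smul_self i (mu : E)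
  have s_s := hPsi.weylPerm_simpleReflection_twice i mu
  rcases hPsi.weightPairing_eq i mu with hmu | hmu | hmu
  · have s_mu := hPsi.weylPerm_simpleReflection_of_eq_zero hmu
    simp [n, x_apply, y_apply, e_apply, f_apply, hmu, s_mu, reflSign]
  all_goals
    simp [n, x_apply, y_apply, e_apply, f_apply, hmu, weight_s, s_s, reflSign, signUnit,
      Units.smul_def, smul_smul]

end Generators

section Torus

variable {ι E E' : Type*} [AddCommGroup E] [Module ℚ E] [AddCommGroup E'] [Module ℚ E']
  {P : RootPairing ι ℚ E E'} {b : P.Base} {Psi : Set E}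
  {R V : Type*} [CommRing R] [AddCommGroup V] [Module R V]
  (hPsi : IsMinusculeUnion b Psi) (z : Basis Psi R V)

theorem isMonomial_n_mul_n (i : b.support) (s t : Rˣ) :
    IsMonomial z 1 (fun mu => (-(s * t⁻¹)) ^ weightPairing P i mu)
      (n hPsi z i s * n hPsi z i t) := by
  have signUnit_neg_one : signUnit R (-1) = -1 := Units.map_neg_one (Int.castRingHom R)
  refine ((isMonomial_n hPsi z i s).mul (isMonomial_n hPsi z i t)).congr ?_ fun mu => ?_
  · rw [← map_mul, simpleReflection_mul_self, map_one]
  · rw [hPsi.coe_weylPerm, weightPairing_simpleReflection_smul_self]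
    rcases hPsi.weightPairing_eq i mu with hmu | hmu | hmu <;>
      simp [hmu, reflSign, signUnit_neg_one, mul_comm]

theorem isMonomial_h (i : b.support) (t : Rˣ) :
    IsMonomial z 1 (fun mu => t ^ weightPairing P i mu) (h hPsi z i t) :=
  (isMonomial_n_mul_n hPsi z i t (-1)).congr rfl fun mu => by
    rw [inv_neg, inv_one, mul_neg, mul_one, neg_neg]

theorem n_mul_n (i : b.support) (s t : Rˣ) :
    n hPsi z i s * n hPsi z i t = h hPsi z i (-(s * t⁻¹)) :=
  (isMonomial_n_mul_n hPsi z i s t).eq (isMonomial_h hPsi z i _)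

theorem n_neg (i : b.support) (t : Rˣ) : n hPsi z i (-t) = (n hPsi z i t)⁻¹ := by
  refine eq_inv_of_mul_eq_one_left (IsMonomial.eq ?_ (IsMonomial.one (z := z)))
  refine (isMonomial_n_mul_n hPsi z i (-t) t).congr rfl fun mu => ?_
  rw [neg_mul, neg_neg, mul_inv_cancel, one_zpow, Pi.one_apply]

theorem h_mul_n_one (i : b.support) (t : Rˣ) : h hPsi z i t * n hPsi z i 1 = n hPsi z i t := by
  rw [h, n_neg, inv_mul_cancel_right]

theorem h_mem_H (i : b.support) (t : Rˣ) : h hPsi z i t ∈ H hPsi z :=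
  Subgroup.subset_closure ⟨i, t, rfl⟩

variable [P.IsCrystallographic]

theorem n_mul_h (i j : b.support) (s t : Rˣ) :
    n hPsi z i s * h hPsi z j t =
      h hPsi z j t * h hPsi z i (t ^ (-P.pairingIn ℤ i j)) * n hPsi z i s := by
  refine ((isMonomial_n hPsi z i s).mul (isMonomial_h hPsi z j t)).eq <|
    (((isMonomial_h hPsi z j t).mul (isMonomial_h hPsi z i _)).mul
      (isMonomial_n hPsi z i s)).congr (by rw [mul_one, one_mul, mul_one]) fun mu => ?_
  rw [Equiv.Perm.one_apply, Equiv.Perm.one_apply, hPsi.coe_weylPerm,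
    weightPairing_simpleReflection_smul_self, hPsi.weightPairing_simpleReflection_smul,
    ← zpow_mul, ← zpow_add, mul_comm (t ^ _)]
  congr 2
  ring

theorem n_conj_mem_H (i : b.support) (s : Rˣ) {g : LinearMap.GeneralLinearGroup R V}
    (hg : g ∈ H hPsi z) : n hPsi z i s * g * (n hPsi z i s)⁻¹ ∈ H hPsi z := by
  change g ∈ (H hPsi z).comap (MulAut.conj (n hPsi z i s)).toMonoidHom
  refine (Subgroup.closure_le _).2 ?_ hg
  rintro _ ⟨j, t, rfl⟩
  change n hPsi z i s * h hPsi z j t * (n hPsi z i s)⁻¹ ∈ H hPsi z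
  rw [n_mul_h, mul_inv_cancel_right]
  exact mul_mem (h_mem_H hPsi z j t) (h_mem_H hPsi z i _)

theorem N_le_normalizer_H :
    N hPsi z ≤ Subgroup.normalizer (H hPsi z : Set (LinearMap.GeneralLinearGroup R V)) := by
  refine (Subgroup.closure_le _).2 ?_
  rintro _ ⟨i, t, rfl⟩
  refine Subgroup.mem_normalizer_iff.2 fun g => ⟨n_conj_mem_H hPsi z i t, fun hg => ?_⟩
  have := n_conj_mem_H hPsi z i (-t) hg
  rwa [n_neg, inv_inv, ← mul_assoc, inv_mul_cancel_left, inv_mul_cancel_right] at this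

instance normal_subgroupOf_H_N : ((H hPsi z).subgroupOf (N hPsi z)).Normal :=
  (Subgroup.normal_subgroupOf_iff_le_normalizer (H_le_N hPsi z)).2 (N_le_normalizer_H hPsi z)

end Torus

section Lifts

variable {ι E E' : Type*} [AddCommGroup E] [Module ℚ E] [AddCommGroup E'] [Module ℚ E']
  {P : RootPairing ι ℚ E E'} {b : P.Base} {Psi : Set E}
  {R V : Type*} [CommRing R] [AddCommGroup V] [Module R V]
  (hPsi : IsMinusculeUnion b Psi) (z : Basis Psi R V)

/-- The element `n_i = n_i(1)` of `N`, which lifts the simple reflection `s_i`. -/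
def simpleLift (i : b.support) : N hPsi z :=
  ⟨n hPsi z i 1, n_mem_N hPsi z i 1⟩

/-- The signs of the monomial matrix of a word in the `n_i(1)`; they are the same for all
coefficient rings. -/
def wordSign : List b.support → Psi → ℤˣ
  | [], _ => 1
  | i :: l, mu =>
    wordSign l mu * reflSign (weightPairing P i ((l.map (simpleReflection b)).prod • (mu : E)))

theorem isMonomial_prod_simpleLift (l : List b.support) :
    IsMonomial z (hPsi.weylPerm (l.map (simpleReflection b)).prod)
      (fun mu => signUnit R (wordSign l mu))
      ((l.map (simpleLift hPsi z)).prod : N hPsi z) := by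
  induction l with
  | nil => exact IsMonomial.one.congr (map_one hPsi.weylPerm).symm fun mu => (map_one _).symm
  | cons i l ih =>
    refine ((isMonomial_n hPsi z i 1).mul ih).congr (map_mul hPsi.weylPerm _ _).symm fun mu => ?_
    rw [wordSign, map_mul, one_zpow, mul_one, hPsi.coe_weylPerm]

end Lifts

section Relations

variable {ι E E' : Type*} [AddCommGroup E] [Module ℚ E] [AddCommGroup E'] [Module ℚ E']
  {P : RootPairing ι ℚ E E'} {b : P.Base} {Psi : Set E}
  {R V : Type*} [CommRing R] [AddCommGroup V] [Module R V]
  (hPsi : IsMinusculeUnion b Psi) (z : Basis Psi R V)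

theorem lie_e_f_apply (i : b.support) (mu : Psi) :
    ⁅e hPsi z i, f hPsi z i⁆ (z mu) = (weightPairing P i mu : R) • z mu := by
  have weight_s : weightPairing P i (hPsi.weylPerm (simpleReflection b i) mu : E) =
      -weightPairing P i mu :=
    weightPairing_simpleReflection_smul_self i (mu : E)
  have s_s := hPsi.weylPerm_simpleReflection_twice i mu
  rw [Ring.lie_def, LinearMap.sub_apply, Module.End.mul_apply, Module.End.mul_apply]
  rcases hPsi.weightPairing_eq i mu with hmu | hmu | hmu <;>
    simp [e_apply, f_apply, hmu, weight_s, s_s]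

theorem lie_e_f_lie_e [P.IsCrystallographic] (i j : b.support) :
    ⁅⁅e hPsi z i, f hPsi z i⁆, e hPsi z j⁆ = (P.pairingIn ℤ j i : R) • e hPsi z j := by
  refine z.ext fun mu => ?_
  rw [Ring.lie_def, LinearMap.sub_apply, Module.End.mul_apply, Module.End.mul_apply, lie_e_f_apply,
    map_smul, LinearMap.smul_apply, e_apply]
  split_ifs with hmu
  · rw [lie_e_f_apply, hPsi.coe_weylPerm, hPsi.weightPairing_simpleReflection_smul, hmu, ← sub_smul]
    push_cast
    ring_nf
  · simp only [map_zero, smul_zero, sub_zero]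

theorem lie_e_f_lie_f [P.IsCrystallographic] (i j : b.support) :
    ⁅⁅e hPsi z i, f hPsi z i⁆, f hPsi z j⁆ = (-P.pairingIn ℤ j i : R) • f hPsi z j := by
  refine z.ext fun mu => ?_
  rw [Ring.lie_def, LinearMap.sub_apply, Module.End.mul_apply, Module.End.mul_apply, lie_e_f_apply,
    map_smul, LinearMap.smul_apply, f_apply]
  split_ifs with hmu
  · rw [lie_e_f_apply, hPsi.coe_weylPerm, hPsi.weightPairing_simpleReflection_smul, hmu, ← sub_smul]
    push_cast
    ring_nf
  · simp only [map_zero, smul_zero, sub_zero]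

variable [Finite ι] [P.IsCrystallographic]

theorem e_f_apply {i j : b.support} (hij : i ≠ j) (mu : Psi) :
    e hPsi z i (f hPsi z j (z mu)) =
      if weightPairing P i mu = -1 ∧ weightPairing P j mu = 1 ∧ P.pairingIn ℤ j i = 0 then
        z (hPsi.weylPerm (simpleReflection b i * simpleReflection b j) mu) else 0 := by
  have cartan_nonpos : P.pairingIn ℤ j i ≤ 0 :=
    b.pairingIn_le_zero_of_ne (Subtype.coe_injective.ne hij.symm) j.2 i.2
  have weight_i := hPsi.weightPairing_eq i mu
  have weight_s := hPsi.weightPairing_simpleReflection_smul j i mu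
  rw [f_apply]
  split_ifs with hj hcond hcond
  · rw [e_apply, if_pos, map_mul, Equiv.Perm.mul_apply]
    rw [hPsi.coe_weylPerm, weight_s, hcond.1, hcond.2.2, mul_zero, sub_zero]
  · rw [e_apply, if_neg]
    rw [hPsi.coe_weylPerm, weight_s, hj]
    lia
  · exact absurd hcond.2.1 hj
  · exact map_zero _

theorem f_e_apply {i j : b.support} (hij : i ≠ j) (mu : Psi) :
    f hPsi z j (e hPsi z i (z mu)) =
      if weightPairing P i mu = -1 ∧ weightPairing P j mu = 1 ∧ P.pairingIn ℤ i j = 0 then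
        z (hPsi.weylPerm (simpleReflection b j * simpleReflection b i) mu) else 0 := by
  have cartan_nonpos : P.pairingIn ℤ i j ≤ 0 :=
    b.pairingIn_le_zero_of_ne (Subtype.coe_injective.ne hij) i.2 j.2
  have weight_j := hPsi.weightPairing_eq j mu
  have weight_s := hPsi.weightPairing_simpleReflection_smul i j mu
  rw [e_apply]
  split_ifs with hi hcond hcond
  · rw [f_apply, if_pos, map_mul, Equiv.Perm.mul_apply]
    rw [hPsi.coe_weylPerm, weight_s, hcond.2.1, hcond.2.2, mul_zero, sub_zero]
  · rw [f_apply, if_neg]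
    rw [hPsi.coe_weylPerm, weight_s, hi]
    lia
  · exact absurd hcond.1 hi
  · exact map_zero _

theorem lie_e_f_of_ne {i j : b.support} (hij : i ≠ j) : ⁅e hPsi z i, f hPsi z j⁆ = 0 := by
  refine z.ext fun mu => ?_
  rw [Ring.lie_def, LinearMap.sub_apply, LinearMap.zero_apply, sub_eq_zero, Module.End.mul_apply,
    Module.End.mul_apply, e_f_apply hPsi z hij, f_e_apply hPsi z hij]
  refine if_ctx_congr ?_ (fun hcond => ?_) fun _ => rfl
  · rw [P.pairingIn_eq_zero_iff (S := ℤ) (i := j)]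
  · have pairing_zero : P.pairing i j = 0 := by
      rw [← P.algebraMap_pairingIn ℤ, hcond.2.2, map_zero]
    have fixes_root : simpleReflection b j • (i : ι) = i := by
      rw [simpleReflection, ofIdx_smul_index, P.reflectionPerm_eq_of_pairing_eq_zero pairing_zero]
    rw [mul_simpleReflection fixes_root]

theorem chevalleyRelations_e_f :
    ChevalleyRelations R (L := Module.End R V) (e hPsi z) (f hPsi z) where
  lie_of_ne _ _ hij := lie_e_f_of_ne hPsi z hij
  left i j := ⟨_, lie_e_f_lie_e hPsi z i j⟩
  right i j := ⟨_, lie_e_f_lie_f hPsi z i j⟩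

end Relations

section ConstantCoeff

variable {ι E E' : Type*} [AddCommGroup E] [Module ℚ E] [AddCommGroup E'] [Module ℚ E']
  {P : RootPairing ι ℚ E E'} {b : P.Base} {Psi : Set E}
  {R V : Type*} [CommRing R] [AddCommGroup V] [Module R V]
  (hPsi : IsMinusculeUnion b Psi) (z : Basis Psi R V)

theorem hasDegree_e (i : b.support) : HasDegree z ((↑) : Psi → E) (P.root i) (e hPsi z i) := by
  refine HasDegree.of_basis fun mu => ?_
  rw [e_apply]
  split_ifs with hmu
  · refine Submodule.subset_span ⟨_, ?_, rfl⟩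
    exact (hPsi.simpleReflection_smul i mu).trans (by rw [hmu, neg_one_smul, sub_neg_eq_add])
  · exact zero_mem _

theorem hasDegree_f (i : b.support) : HasDegree z ((↑) : Psi → E) (-P.root i) (f hPsi z i) := by
  refine HasDegree.of_basis fun mu => ?_
  rw [f_apply]
  split_ifs with hmu
  · refine Submodule.subset_span ⟨_, ?_, rfl⟩
    exact (hPsi.simpleReflection_smul i mu).trans (by rw [hmu, one_smul, sub_eq_add_neg])
  · exact zero_mem _

/-- The endomorphisms whose matrix has the same entry at all positions `(mu + α_j, mu)` with
`(mu, α_j^∨) = -1`. -/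
def constantCoeff (j : b.support) : Submodule R (Module.End R V) where
  carrier := {A | ∃ r : R, ∀ mu : Psi, weightPairing P j mu = -1 →
    z.repr (A (z mu)) (hPsi.weylPerm (simpleReflection b j) mu) = r}
  zero_mem' := ⟨0, fun mu _ => by simp⟩
  add_mem' := by
    rintro A B ⟨r, hr⟩ ⟨s, hs⟩
    exact ⟨r + s, fun mu hmu => by simp [hr mu hmu, hs mu hmu]⟩
  smul_mem' := by
    rintro t A ⟨r, hr⟩
    exact ⟨t * r, fun mu hmu => by simp [hr mu hmu]⟩

theorem e_mem_constantCoeff (j : b.support) : e hPsi z j ∈ constantCoeff hPsi z j :=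
  ⟨1, fun mu hmu => by rw [e_apply, if_pos hmu, Basis.repr_self, Finsupp.single_eq_same]⟩

variable {z} in
theorem HasDegree.mem_constantCoeff {γ : E} {A : Module.End R V}
    (hA : HasDegree z ((↑) : Psi → E) γ A) {j : b.support} (hγ : γ ≠ P.root j) :
    A ∈ constantCoeff hPsi z j := by
  refine ⟨0, fun mu hmu => hA.repr_eq_zero fun hdeg => hγ ?_⟩
  rw [hPsi.coe_weylPerm, hPsi.simpleReflection_smul, hmu, neg_one_smul, sub_neg_eq_add] at hdeg
  exact (add_left_cancel hdeg).symm

theorem exists_height {ι k M M' : Type*} [Field k] [AddCommGroup M] [Module k M] [AddCommGroup M']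
    [Module k M'] {P : RootPairing ι k M M'} (b : P.Base) :
    ∃ ht : M →ₗ[k] k, ∀ i : b.support, ht (P.root i) = 1 := by
  have linearIndependent_root : LinearIndependent k fun i : b.support => P.root i :=
    b.linearIndepOn_root
  let simpleRoots := Basis.span linearIndependent_root
  obtain ⟨ht, hht⟩ := (simpleRoots.constr k fun _ => (1 : k)).exists_extend
  refine ⟨ht, fun i => ?_⟩
  rw [← Basis.coe_span_apply linearIndependent_root i]
  exact (LinearMap.congr_fun hht (simpleRoots i)).trans (simpleRoots.constr_basis k _ i)

theorem triangularSpan_e_f_le_constantCoeff (j : b.support) :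
    triangularSpan R (L := Module.End R V) (e hPsi z) (f hPsi z) ≤ constantCoeff hPsi z j := by
  obtain ⟨ht, hht⟩ := exists_height b
  refine Submodule.span_le.2 ?_
  rintro A ((hA | ⟨i, rfl⟩) | hA)
  · obtain ⟨k, γ, hAγ, htγ, hk⟩ := hA.exists_hasDegree (hasDegree_e hPsi z) ht.toAddMonoidHom hht
    rcases k.eq_zero_or_pos with rfl | hpos
    · obtain ⟨i, rfl⟩ := hk rfl
      rcases eq_or_ne i j with rfl | hij
      · exact e_mem_constantCoeff hPsi z i
      · exact (hasDegree_e hPsi z i).mem_constantCoeff hPsi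
          (P.root.injective.ne (Subtype.coe_injective.ne hij))
    · refine hAγ.mem_constantCoeff hPsi fun hγ => ?_
      have height_eq : ((k + 1 : ℕ) : ℚ) = 1 := by
        rw [← nsmul_one (k + 1), ← htγ, hγ]
        exact hht j
      exact hpos.ne' (Nat.succ_injective (Nat.cast_eq_one.1 height_eq))
  · refine ((hasDegree_e hPsi z i).lie (hasDegree_f hPsi z i)).mem_constantCoeff hPsi ?_
    rw [add_neg_cancel]
    exact (P.ne_zero j).symm
  · have ht_neg : ∀ i : b.support, ht.toAddMonoidHom (-P.root i) = -1 := fun i =>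
      (map_neg ht _).trans (congrArg Neg.neg (hht i))
    obtain ⟨k, γ, hAγ, htγ, -⟩ := hA.exists_hasDegree (hasDegree_f hPsi z) ht.toAddMonoidHom ht_neg
    refine hAγ.mem_constantCoeff hPsi fun hγ => ?_
    have height_eq : (1 : ℚ) = -((k + 1 : ℕ) : ℚ) := by
      rw [← nsmul_one (k + 1), ← smul_neg, ← htγ, hγ]
      exact (hht j).symm
    have : (0 : ℚ) ≤ ((k + 1 : ℕ) : ℚ) := Nat.cast_nonneg _
    linarith

end ConstantCoeff

section Signs

variable {ι E E' : Type*} [Finite ι] [AddCommGroup E] [Module ℚ E] [AddCommGroup E'] [Module ℚ E']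
  {P : RootPairing ι ℚ E E'} [P.IsCrystallographic] {b : P.Base} {Psi : Set E}
  {R V : Type*} [CommRing R] [AddCommGroup V] [Module R V]
  (hPsi : IsMinusculeUnion b Psi) (z : Basis Psi R V)

/-- The invertible maps under which the space `T` of endomorphisms is stable by conjugation. -/
def conjStabilizer (T : Submodule R (Module.End R V)) :
    Submonoid (LinearMap.GeneralLinearGroup R V) where
  carrier := {g | ∀ A ∈ T,
    (g : Module.End R V) * A * (g⁻¹ : LinearMap.GeneralLinearGroup R V) ∈ T}
  one_mem' A hA := by rwa [inv_one, Units.val_one, one_mul, mul_one]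
  mul_mem' {g g'} hg hg' A hA := by
    have := hg _ (hg' A hA)
    rwa [mul_inv_rev, Units.val_mul, Units.val_mul, ← mul_assoc, mul_assoc (g : Module.End R V),
      mul_assoc (g : Module.End R V)]

theorem x_mem_conjStabilizer (h2 : IsUnit (2 : R)) (i : b.support) (t : R) :
    x hPsi z i t ∈ conjStabilizer (triangularSpan R (e hPsi z) (f hPsi z)) := fun _ hA =>
  oneAdd_conj_mem h2 _ (fun B hB => by
    rw [smul_lie]
    exact Submodule.smul_mem _ t ((chevalleyRelations_e_f hPsi z).lie_left_mem i hB)) hA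

theorem y_mem_conjStabilizer (h2 : IsUnit (2 : R)) (i : b.support) (t : R) :
    y hPsi z i t ∈ conjStabilizer (triangularSpan R (e hPsi z) (f hPsi z)) := fun _ hA =>
  oneAdd_conj_mem h2 _ (fun B hB => by
    rw [smul_lie]
    exact Submodule.smul_mem _ t ((chevalleyRelations_e_f hPsi z).lie_right_mem i hB)) hA

theorem prod_simpleLift_mem_conjStabilizer (h2 : IsUnit (2 : R)) (l : List b.support) :
    ((l.map (simpleLift hPsi z)).prod : LinearMap.GeneralLinearGroup R V) ∈
      conjStabilizer (triangularSpan R (e hPsi z) (f hPsi z)) := by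
  refine Submonoid.list_prod_mem ((conjStabilizer _).comap (N hPsi z).subtype) ?_
  rw [List.forall_mem_map]
  intro i _
  exact mul_mem (mul_mem (x_mem_conjStabilizer hPsi z h2 i _) (y_mem_conjStabilizer hPsi z h2 i _))
    (x_mem_conjStabilizer hPsi z h2 i _)

/-- Over `ℚ`, conjugation by the word sends `e_i` to an element of the triangular span, whose
coefficients along `α_j` are constant; these coefficients are the quotients of signs below. -/
theorem wordSign_div_eq {l : List b.support} {i j : b.support}
    (hij : (l.map (simpleReflection b)).prod • (i : ι) = j) {mu nu : Psi}
    (hmu : weightPairing P i mu = -1) (hnu : weightPairing P i nu = -1) :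
    wordSign l (hPsi.weylPerm (simpleReflection b i) mu) / wordSign l mu =
      wordSign l (hPsi.weylPerm (simpleReflection b i) nu) / wordSign l nu := by
  let z : Basis Psi ℚ (Psi →₀ ℚ) := Finsupp.basisSingleOne
  let w := (l.map (simpleReflection b)).prod
  let g : LinearMap.GeneralLinearGroup ℚ (Psi →₀ ℚ) := (l.map (simpleLift hPsi z)).prod
  obtain ⟨r, hr⟩ : (g * e hPsi z i * (g⁻¹ : LinearMap.GeneralLinearGroup ℚ _) :
      Module.End ℚ (Psi →₀ ℚ)) ∈ constantCoeff hPsi z j :=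
    triangularSpan_e_f_le_constantCoeff hPsi z j
      (prod_simpleLift_mem_conjStabilizer hPsi z (IsUnit.mk0 _ two_ne_zero) l _
        (Submodule.subset_span (Or.inl (Or.inl (.base i)))))
  have coeff_eq {lam : Psi} (hlam : weightPairing P i lam = -1) :
      (signUnit ℚ (wordSign l (hPsi.weylPerm (simpleReflection b i) lam) / wordSign l lam) : ℚ) =
        r := by
    rw [← hr (hPsi.weylPerm w lam) (by rw [hPsi.coe_weylPerm, ← hij, weightPairing_smul, hlam]),
      (isMonomial_prod_simpleLift hPsi z l).conj_apply ((e_apply hPsi z i lam).trans (if_pos hlam)),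
      ← Equiv.Perm.mul_apply, ← map_mul, ← Equiv.Perm.mul_apply, ← map_mul,
      mul_simpleReflection hij, Units.smul_def, map_smul, Basis.repr_self, Finsupp.smul_single,
      Finsupp.single_eq_same, smul_eq_mul, mul_one, map_div, div_eq_mul_inv]
  have sign_eq := (coeff_eq hmu).trans (coeff_eq hnu).symm
  exact Units.map_injective Int.cast_injective (Units.ext sign_eq)

theorem exists_wordSign_eq {l : List b.support} {i j : b.support}
    (hij : (l.map (simpleReflection b)).prod • (i : ι) = j) :
    ∃ c : ℤˣ, ∀ mu : Psi, wordSign l (hPsi.weylPerm (simpleReflection b i) mu) =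
      wordSign l mu * c ^ (-weightPairing P i mu) := by
  obtain ⟨c, hc⟩ : ∃ c : ℤˣ, ∀ mu : Psi, weightPairing P i mu = -1 →
      wordSign l (hPsi.weylPerm (simpleReflection b i) mu) / wordSign l mu = c := by
    by_cases hex : ∃ nu : Psi, weightPairing P i nu = -1
    · obtain ⟨nu, hnu⟩ := hex
      exact ⟨_, fun mu hmu => wordSign_div_eq hPsi hij hmu hnu⟩
    · exact ⟨1, fun mu hmu => absurd ⟨mu, hmu⟩ hex⟩
  refine ⟨c, fun mu => ?_⟩
  rcases hPsi.weightPairing_eq i mu with hmu | hmu | hmu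
  · rw [hPsi.weylPerm_simpleReflection_of_eq_zero hmu, hmu, neg_zero, zpow_zero, mul_one]
  · have weight_s : weightPairing P i (hPsi.weylPerm (simpleReflection b i) mu : E) = -1 := by
      rw [hPsi.coe_weylPerm, weightPairing_simpleReflection_smul_self, hmu]
    have sign_s := hc _ weight_s
    rw [hPsi.weylPerm_simpleReflection_twice] at sign_s
    rw [hmu, zpow_neg_one, ← sign_s, inv_div, mul_div_cancel]
  · rw [hmu, neg_neg, zpow_one, ← hc mu hmu, mul_div_cancel]

theorem exists_prod_simpleLift_mul_n {l : List b.support} {i j : b.support}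
    (hij : (l.map (simpleReflection b)).prod • (i : ι) = j) :
    ∃ t : Rˣ, ((l.map (simpleLift hPsi z)).prod : N hPsi z) * n hPsi z i 1 =
      n hPsi z j t * ((l.map (simpleLift hPsi z)).prod : N hPsi z) := by
  obtain ⟨c, hc⟩ := exists_wordSign_eq hPsi hij
  refine ⟨signUnit R c, ((isMonomial_prod_simpleLift hPsi z l).mul (isMonomial_n hPsi z i 1)).eq
    (((isMonomial_n hPsi z j (signUnit R c)).mul (isMonomial_prod_simpleLift hPsi z l)).congr ?_
      fun mu => ?_)⟩
  · rw [← map_mul, ← map_mul, mul_simpleReflection hij]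
  · rw [hPsi.coe_weylPerm, ← hij, weightPairing_smul, one_zpow, mul_one, hc, map_mul, map_zpow]
    exact mul_left_comm _ _ _

end Signs

section Quotient

variable {ι E E' : Type*} [AddCommGroup E] [Module ℚ E] [AddCommGroup E'] [Module ℚ E']
  {P : RootPairing ι ℚ E E'} {b : P.Base} {Psi : Set E}
  {R V : Type*} [CommRing R] [AddCommGroup V] [Module R V]
  (hPsi : IsMinusculeUnion b Psi) (z : Basis Psi R V)

theorem isMonomial_of_mem_H {g : LinearMap.GeneralLinearGroup R V} (hg : g ∈ H hPsi z) :
    ∃ c, IsMonomial z 1 c g := by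
  induction hg using Subgroup.closure_induction with
  | mem _ hg =>
    obtain ⟨i, t, rfl⟩ := hg
    exact ⟨_, isMonomial_h hPsi z i t⟩
  | one => exact ⟨1, .one⟩
  | mul _ _ _ _ hg hg' =>
    obtain ⟨c, hc⟩ := hg
    obtain ⟨c', hc'⟩ := hg'
    exact ⟨_, hc.mul hc'⟩
  | inv _ _ hg =>
    obtain ⟨c, hc⟩ := hg
    exact ⟨_, hc.inv⟩

variable [P.IsCrystallographic]

/-- The class of `n_i(1)` in `N / H`. -/
def simpleClass (i : b.support) : N hPsi z ⧸ (H hPsi z).subgroupOf (N hPsi z) :=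
  (simpleLift hPsi z i : N hPsi z)

theorem mk_n (i : b.support) (t : Rˣ) :
    ((⟨n hPsi z i t, n_mem_N hPsi z i t⟩ : N hPsi z) :
      N hPsi z ⧸ (H hPsi z).subgroupOf (N hPsi z)) = simpleClass hPsi z i := by
  let torusElement : N hPsi z := ⟨h hPsi z i t, H_le_N hPsi z (h_mem_H hPsi z i t)⟩
  have n_eq :
      (⟨n hPsi z i t, n_mem_N hPsi z i t⟩ : N hPsi z) = torusElement * simpleLift hPsi z i :=
    Subtype.ext (h_mul_n_one hPsi z i t).symm
  rw [n_eq, QuotientGroup.mk_mul, (QuotientGroup.eq_one_iff torusElement).2 (h_mem_H hPsi z i t),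
    one_mul, simpleClass]

theorem simpleClass_mul_self (i : b.support) :
    simpleClass hPsi z i * simpleClass hPsi z i = 1 := by
  refine (QuotientGroup.eq_one_iff (simpleLift hPsi z i * simpleLift hPsi z i)).2 ?_
  change n hPsi z i 1 * n hPsi z i 1 ∈ H hPsi z
  rw [n_mul_n]
  exact h_mem_H hPsi z i _

theorem prod_simpleClass (l : List b.support) :
    (l.map (simpleClass hPsi z)).prod =
      ((l.map (simpleLift hPsi z)).prod : N hPsi z ⧸ (H hPsi z).subgroupOf (N hPsi z)) := by
  rw [← QuotientGroup.mk'_apply, map_list_prod, List.map_map]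
  rfl

theorem prod_simpleClass_mul [Finite ι] {l : List b.support} {i j : b.support}
    (hij : (l.map (simpleReflection b)).prod • (i : ι) = j) :
    (l.map (simpleClass hPsi z)).prod * simpleClass hPsi z i =
      simpleClass hPsi z j * (l.map (simpleClass hPsi z)).prod := by
  obtain ⟨t, ht⟩ := exists_prod_simpleLift_mul_n hPsi z hij
  rw [prod_simpleClass, ← mk_n hPsi z j t]
  exact congrArg QuotientGroup.mk (Subtype.ext ht)

theorem closure_range_simpleClass : Subgroup.closure (Set.range (simpleClass hPsi z)) = ⊤ := by
  set K := Subgroup.closure (Set.range (simpleClass hPsi z))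
  have N_le : N hPsi z ≤ (K.comap (QuotientGroup.mk' _)).map (N hPsi z).subtype := by
    refine (Subgroup.closure_le _).2 ?_
    rintro _ ⟨i, t, rfl⟩
    have mk_n_mem : ((⟨n hPsi z i t, n_mem_N hPsi z i t⟩ : N hPsi z) :
        N hPsi z ⧸ (H hPsi z).subgroupOf (N hPsi z)) ∈ K :=
      mk_n hPsi z i t ▸ Subgroup.subset_closure ⟨i, rfl⟩
    exact ⟨_, mk_n_mem, rfl⟩
  refine eq_top_iff.2 fun q _ => ?_
  obtain ⟨g, rfl⟩ := QuotientGroup.mk_surjective q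
  obtain ⟨g', hg', hgg'⟩ := N_le g.2
  exact Subtype.ext hgg' ▸ hg'

variable [Finite ι] [P.IsReduced]

/-- The homomorphism `W → N / H` with `s_i ↦ n_i(1) H`. -/
def toQuotient : P.weylGroup →* N hPsi z ⧸ (H hPsi z).subgroupOf (N hPsi z) :=
  (exists_monoidHom_simpleReflection (simpleClass_mul_self hPsi z)
    fun _ _ _ => prod_simpleClass_mul hPsi z).choose

theorem toQuotient_simpleReflection (i : b.support) :
    toQuotient hPsi z (simpleReflection b i) = simpleClass hPsi z i :=
  (exists_monoidHom_simpleReflection (simpleClass_mul_self hPsi z)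
    fun _ _ _ => prod_simpleClass_mul hPsi z).choose_spec i

theorem toQuotient_surjective : Function.Surjective (toQuotient hPsi z) := by
  rw [← MonoidHom.range_eq_top, eq_top_iff, ← closure_range_simpleClass, Subgroup.closure_le]
  rintro _ ⟨i, rfl⟩
  exact ⟨_, toQuotient_simpleReflection hPsi z i⟩

theorem weylPerm_eq_one_of_toQuotient_eq_one [Nontrivial R] {w : P.weylGroup}
    (hw : toQuotient hPsi z w = 1) : hPsi.weylPerm w = 1 := by
  obtain ⟨l, rfl⟩ := exists_prod_simpleReflection_eq (b := b) w
  rw [map_list_prod, List.map_map,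
    show toQuotient hPsi z ∘ simpleReflection b = simpleClass hPsi z from
      funext (toQuotient_simpleReflection hPsi z), prod_simpleClass,
    QuotientGroup.eq_one_iff, Subgroup.mem_subgroupOf] at hw
  obtain ⟨c, hc⟩ := isMonomial_of_mem_H hPsi z hw
  exact (isMonomial_prod_simpleLift hPsi z l).perm_eq hc

end Quotient

end MinusculeChevalley

end

theorem lemma3p8_general {ι E E' : Type*} [Finite ι]
    [AddCommGroup E] [Module ℚ E] [AddCommGroup E'] [Module ℚ E']
    (P : RootPairing ι ℚ E E') [P.IsCrystallographic] [P.IsReduced] (b : P.Base)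
    (Psi : Set E) (hPsi : MinusculeChevalley.IsMinusculeUnion b Psi)
    (hfaithful : ∀ w : P.weylGroup, (∀ mu ∈ Psi, w • mu = mu) → w = 1)
    {R : Type*} [CommRing R] [Nontrivial R] {V : Type*} [AddCommGroup V] [Module R V]
    (z : Module.Basis Psi R V) :
    ∃ _normal : ((MinusculeChevalley.H hPsi z).subgroupOf (MinusculeChevalley.N hPsi z)).Normal,
      ∃! phi : P.weylGroup ≃*
          MinusculeChevalley.N hPsi z ⧸
            (MinusculeChevalley.H hPsi z).subgroupOf (MinusculeChevalley.N hPsi z),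
        ∀ i : b.support,
          phi (RootPairing.weylGroup.ofIdx P i) =
            ((⟨MinusculeChevalley.n hPsi z i 1, MinusculeChevalley.n_mem_N hPsi z i 1⟩ :
                MinusculeChevalley.N hPsi z) :
              MinusculeChevalley.N hPsi z ⧸
                (MinusculeChevalley.H hPsi z).subgroupOf (MinusculeChevalley.N hPsi z)) := by
  have injective : Function.Injective (MinusculeChevalley.toQuotient hPsi z) := by
    refine (injective_iff_map_eq_one _).2 fun w hw => hfaithful w fun mu hmu => ?_
    have fixes := MinusculeChevalley.weylPerm_eq_one_of_toQuotient_eq_one hPsi z hw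
    exact congrArg Subtype.val (Equiv.congr_fun fixes ⟨mu, hmu⟩)
  refine ⟨inferInstance, MulEquiv.ofBijective (MinusculeChevalley.toQuotient hPsi z)
    ⟨injective, MinusculeChevalley.toQuotient_surjective hPsi z⟩,
    MinusculeChevalley.toQuotient_simpleReflection hPsi z,
    fun phi hphi => MulEquiv.toMonoidHom_injective ?_⟩
  refine MonoidHom.eq_of_eqOn_dense (MinusculeChevalley.closure_range_simpleReflection b) ?_
  rintro _ ⟨i, rfl⟩
  exact (hphi i).trans (MinusculeChevalley.toQuotient_simpleReflection hPsi z i).symm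

theorem lemma3p8 {ι E E' : Type*} [Finite ι]
    [AddCommGroup E] [Module ℚ E] [AddCommGroup E'] [Module ℚ E']
    (P : RootPairing ι ℚ E E') [P.IsRootSystem] [P.IsCrystallographic] [P.IsReduced]
    [P.IsIrreducible] (b : P.Base)
    (Psi : Set E) (hPsi : MinusculeChevalley.IsMinusculeUnion b Psi)
    {R : Type*} [CommRing R] [Nontrivial R] {V : Type*} [AddCommGroup V] [Module R V]
    (z : Module.Basis Psi R V) :
    ∃ _normal : ((MinusculeChevalley.H hPsi z).subgroupOf (MinusculeChevalley.N hPsi z)).Normal,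
      ∃! phi : P.weylGroup ≃*
          MinusculeChevalley.N hPsi z ⧸
            (MinusculeChevalley.H hPsi z).subgroupOf (MinusculeChevalley.N hPsi z),
        ∀ i : b.support,
          phi (RootPairing.weylGroup.ofIdx P i) =
            ((⟨MinusculeChevalley.n hPsi z i 1, MinusculeChevalley.n_mem_N hPsi z i 1⟩ :
                MinusculeChevalley.N hPsi z) :
              MinusculeChevalley.N hPsi z ⧸
                (MinusculeChevalley.H hPsi z).subgroupOf (MinusculeChevalley.N hPsi z)) := by
  exact lemma3p8_general P b Psi hPsi (fun _ => hPsi.eq_one_of_forall_smul_eq) z
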